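/- Let $K$ be a field, $n\ge 4$, and $S=K[x_1,\dots,x_n]$ with the standard grading. For a graded ideal $I$ of $S$ let $\beta_{i,j}(I)=\dim_K \operatorname{Tor}^S_i(K,I)_j$; a pair $(k,\ell)$ is a corner of $I$ (and $\beta_{k,k+\ell}(I)$ is extremal) if $\beta_{k,k+\ell}(I)\ne 0$ and $\beta_{i,i+j}(I)=0$ for all $i\ge k$, $j\ge \ell$ with $(i,j)\neq(k,\ell)$. A monomial ideal $I$ with minimal monomial generating set $G(I)$ is strongly stable if $x_ju/x_i\in I$ for all $u\in G(I)$, all $x_i$ dividing $u$ and all $j<i$; its initial degree is the least degree of a nonzero homogeneous element. For monomials $u\ge_{\mathrm{lex}}v$ of the same degree $d$, let $\mathcal L(u,v)$ be the set of monomials $z$ of degree $d$ with $u\ge_{\mathrm{lex}} z\ge_{\mathrm{lex}} v$, where $x_1>\dots>x_n$. Let $(k_1,\ell_1),\dots,(k_{n-2},\ell_{n-2})$ be pairs of positive integers with $n-1\ge k_1>k_2>\dots>k_{n-2}\ge 2$ and $2=\ell_1<\ell_2<\dots<\ell_{n-2}$. Then there exists a strongly stable ideal $I$ of $S$ of initial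 degree $2$ whose set of corners is exactly $\{(k_1,\ell_1),\dots,(k_{n-2},\ell_{n-2})\}$ if and only if $k_1+1=n$. Moreover, suppose $k_1+1=n$, put $s=\max\{i : 1\le i\le n-2,\ i\le k_i+1\}$, and write $w_i=\prod_{j=2}^{i}x_j^{\ell_j-\ell_{j-1}}$ (so $w_1=1$). Then the monomial ideal generated by - $\mathcal L(x_1^2,\,x_1x_{k_1+1})$, - $\mathcal L(w_ix_i^2,\; w_ix_ix_{k_i+1})$ for $2\le i\le s$, and - $w_{k_i-1}\,x_{k_i}^{\ell_{k_i}-\ell_{k_i-1}-1}\,x_{k_i+1}^{3+\ell_i-\ell_{k_i}}$ for $s<i\le n-2$ has precisely these monomials as its minimal monomial generators, is strongly stable of initial degree $2$, has exactly the given pairs as corners, and satisfies $\beta_{k_i,k_i+\ell_i}(I)=1$ for $i=1,\dots,n-2$. -/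

import Mathlib

open MvPolynomial

noncomputable section

/-! ### Monomial ideals and strongly stable ideals

The polynomial ring is `S = K[x_1, …, x_n] = MvPolynomial (Fin n) K`; the variable `x_j` is
`X a` with `(a : ℕ) + 1 = j`. A monomial is given by its exponent vector `u : Fin n →₀ ℕ`. -/

/-- The ideal generated by the monomials with exponents in `A`. -/
def monomialIdeal (K : Type*) [Field K] {n : ℕ} (A : Set (Fin n →₀ ℕ)) :
    Ideal (MvPolynomial (Fin n) K) :=
  Ideal.span ((fun u => monomial u (1 : K)) '' A)

/-- The (exponents of the) minimal monomial generators `G(I)`: the monomials of `I` that are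
minimal with respect to divisibility. -/
def minGens {K : Type*} [Field K] {n : ℕ} (I : Ideal (MvPolynomial (Fin n) K)) :
    Set (Fin n →₀ ℕ) :=
  {u | monomial u (1 : K) ∈ I ∧ ∀ v : Fin n →₀ ℕ, monomial v (1 : K) ∈ I → v ≤ u → v = u}

/-- A monomial ideal `I` is strongly stable if `x_j u / x_i ∈ I` for all `u ∈ G(I)`, all `x_i`
dividing `u` and all `j < i`. -/
def IsStronglyStable {K : Type*} [Field K] {n : ℕ} (I : Ideal (MvPolynomial (Fin n) K)) : Prop :=
  (∃ A : Set (Fin n →₀ ℕ), I = monomialIdeal K A) ∧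
    ∀ u ∈ minGens I, ∀ i ∈ u.support, ∀ j < i,
      monomial (u - Finsupp.single i 1 + Finsupp.single j 1) (1 : K) ∈ I

/-- The initial degree of a graded ideal: the least degree of a nonzero homogeneous element
(`0` for the zero ideal). -/
def initialDegree {K : Type*} [Field K] {n : ℕ} (I : Ideal (MvPolynomial (Fin n) K)) : ℕ :=
  sInf {s | ∃ f ∈ I, f ≠ 0 ∧ f.IsHomogeneous s}

/-! ### Graded Betti numbers

`Tor_i^S(K, I)_j` is computed by tensoring the Koszul resolution of `K` on `x_1, …, x_n` with `I`.
An element `∑_σ c_σ e_σ` of `⊕_σ S e_σ`, where `e_σ` is the wedge of the `e_a` with `a ∈ σ` taken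
in increasing order, is written as the function `c`. -/

/-- The Koszul differential, `∂ e_σ = ∑_{a ∈ σ} (-1) ^ #{b ∈ σ | b < a} x_a e_{σ \ {a}}`: the
coefficient of `∂ c` at `e_τ` collects the terms with `σ = τ ∪ {a}`, `a ∉ τ`. -/
def koszulDifferential (K : Type*) [Field K] (n : ℕ) :
    (Finset (Fin n) → MvPolynomial (Fin n) K) →ₗ[K] (Finset (Fin n) → MvPolynomial (Fin n) K) where
  toFun c τ := ∑ a ∈ τᶜ, (-1) ^ (τ.filter (· < a)).card * X a * c (insert a τ)
  map_add' c d := by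
    funext τ
    simp [mul_add, Finset.sum_add_distrib]
  map_smul' r c := by
    funext τ
    simp [Finset.smul_sum]

/-- The chains with coefficients in `I` of homological degree `i` and internal degree `j`
(`e_σ` has homological and internal degree `#σ`): `⊕_{#σ = i} I_{j - i} e_σ`. -/
def koszulChains {K : Type*} [Field K] {n : ℕ} (I : Ideal (MvPolynomial (Fin n) K)) (i j : ℕ) :
    Submodule K (Finset (Fin n) → MvPolynomial (Fin n) K) where
  carrier := {c | ∀ σ, c σ ∈ I ∧ ∀ m ∈ (c σ).support, σ.card = i ∧ m.degree + i = j}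
  add_mem' {c d} hc hd σ := by
    refine ⟨I.add_mem (hc σ).1 (hd σ).1, fun m hm => ?_⟩
    classical
    rcases Finset.mem_union.1 (support_add hm) with h | h
    · exact (hc σ).2 m h
    · exact (hd σ).2 m h
  zero_mem' σ := by simp
  smul_mem' r c hc σ := by
    refine ⟨?_, fun m hm => (hc σ).2 m (support_smul hm)⟩
    rw [Pi.smul_apply, smul_eq_C_mul]
    exact I.mul_mem_left _ (hc σ).1

/-- The cycles of homological degree `i` and internal degree `j`. -/
def koszulCycles {K : Type*} [Field K] {n : ℕ} (I : Ideal (MvPolynomial (Fin n) K)) (i j : ℕ) :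
    Submodule K (Finset (Fin n) → MvPolynomial (Fin n) K) :=
  koszulChains I i j ⊓ LinearMap.ker (koszulDifferential K n)

/-- The boundaries of homological degree `i` and internal degree `j`. -/
def koszulBoundaries {K : Type*} [Field K] {n : ℕ} (I : Ideal (MvPolynomial (Fin n) K))
    (i j : ℕ) : Submodule K (Finset (Fin n) → MvPolynomial (Fin n) K) :=
  (koszulChains I (i + 1) j).map (koszulDifferential K n)

/-- `Tor_i^S(K, I)_j` as cycles modulo boundaries. -/
abbrev GradedTor {K : Type*} [Field K] {n : ℕ} (I : Ideal (MvPolynomial (Fin n) K)) (i j : ℕ) :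
    Type _ :=
  koszulCycles I i j ⧸ (koszulBoundaries I i j).comap (koszulCycles I i j).subtype

/-- The graded Betti number `β_{i,j}(I) = dim_K Tor_i^S(K, I)_j`. -/
def gradedBetti {K : Type*} [Field K] {n : ℕ} (I : Ideal (MvPolynomial (Fin n) K)) (i j : ℕ) : ℕ :=
  Module.finrank K (GradedTor I i j)

/-- The set of corners of `I`: the pairs `(k, ℓ)` such that `β_{k,k+ℓ}(I)` is extremal. -/
def corners {K : Type*} [Field K] {n : ℕ} (I : Ideal (MvPolynomial (Fin n) K)) : Set (ℕ × ℕ) :=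
  {p | gradedBetti I p.1 (p.1 + p.2) ≠ 0 ∧
    ∀ i j, p.1 ≤ i → p.2 ≤ j → (i, j) ≠ p → gradedBetti I i (i + j) = 0}

/-! ### The explicit ideal -/

/-- The exponent vector of the variable `x_j`, for `1 ≤ j ≤ n`. -/
def expVar (n j : ℕ) : Fin n →₀ ℕ :=
  Finsupp.equivFunOnFinite.symm fun a => if (a : ℕ) + 1 = j then 1 else 0

/-- The lexicographic segment `{z ∈ Mon_d(S) : u ≥ z ≥ v}`, `d = deg u`, for the lexicographic
order with `x_1 > x_2 > ⋯ > x_n`. -/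
def lexSegment {n : ℕ} (u v : Fin n →₀ ℕ) : Set (Fin n →₀ ℕ) :=
  {z | z.degree = u.degree ∧ toLex v ≤ toLex z ∧ toLex z ≤ toLex u}

/-- The exponent vector of `x_2 ^ (ℓ_2 - ℓ_1) x_3 ^ (ℓ_3 - ℓ_2) ⋯ x_i ^ (ℓ_i - ℓ_{i-1})`. -/
def stepMonomial (n : ℕ) (ℓ : ℕ → ℕ) (i : ℕ) : Fin n →₀ ℕ :=
  ∑ j ∈ Finset.Icc 2 i, (ℓ j - ℓ (j - 1)) • expVar n j

/-- `s = max {i : 1 ≤ i ≤ r, i ≤ k_i + 1}`. -/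
def lastLexIndex (r : ℕ) (k : ℕ → ℕ) : ℕ :=
  ((Finset.Icc 1 r).filter fun i => i ≤ k i + 1).sup id

/-- The generators of degree `ℓ_i` of the explicit ideal:
* for `i = 1`, the segment from `x_1 ^ 2` to `x_1 x_{k_1 + 1}`;
* for `2 ≤ i ≤ s`, the segment from `w x_i ^ 2` to `w x_i x_{k_i + 1}`, where
  `w = x_2 ^ (ℓ_2 - 2) x_3 ^ (ℓ_3 - ℓ_2) ⋯ x_i ^ (ℓ_i - ℓ_{i-1})`;
* for `i > s`, with `k = k_i`, the single monomial
  `x_2 ^ (ℓ_2 - 2) ⋯ x_{k-1} ^ (ℓ_{k-1} - ℓ_{k-2}) x_k ^ (ℓ_k - ℓ_{k-1} - 1)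
    x_{k+1} ^ (3 + ℓ_i - ℓ_k)`. -/
def cornerGens (n r : ℕ) (k ℓ : ℕ → ℕ) (i : ℕ) : Set (Fin n →₀ ℕ) :=
  if i = 1 then
    lexSegment (2 • expVar n 1) (expVar n 1 + expVar n (k 1 + 1))
  else if i ≤ lastLexIndex r k then
    lexSegment (stepMonomial n ℓ i + 2 • expVar n i)
      (stepMonomial n ℓ i + expVar n i + expVar n (k i + 1))
  else
    {stepMonomial n ℓ (k i - 1) + (ℓ (k i) - ℓ (k i - 1) - 1) • expVar n (k i) +
      (3 + ℓ i - ℓ (k i)) • expVar n (k i + 1)}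

end

/-!
The hypotheses ask for `n - 2` strictly decreasing integers `k_i` between `2` and `n - 1`, so
`k_i = n - i` for all `i` (`eq_sub_of_strictAntiOn`). In particular `k_1 + 1 = n` always holds, and
both parts of the theorem follow once the explicit ideal is shown to have the asserted properties.

**Betti numbers.** For a strongly stable ideal `I` the Eliahou–Kervaire formula
(`IsStronglyStable.gradedBetti_eq`) says that `β_{i,j}(I)` is the number of pairs `(u, σ)` with
`u ∈ G(I)`, `#σ = i`, `deg u + i = j`, such that every index in `σ` is smaller than that of the last
variable of `u`. It is proved on the Koszul complex itself. The chains with coefficients in `I` have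
the basis `x^m e_σ`, `x^m ∈ I`, which is split into three classes:

* `B`: `max σ` is at least the index of the last variable of `x^m` (`Dominates`);
* `C`: not in `B`, and `x^m ∈ G(I)`;
* `A`: not in `B`, and `x^m ∉ G(I)`; then `x^m` divided by its last variable is still in `I`
  (`IsStronglyStable.exists_last_div_mem`).

The component of `∂` from `B` to `A` is, up to signs, the bijection
`x^m e_σ ↦ x^m x_t e_{σ \ {t}}`, `t = max σ` (`coeff_koszulDifferential_of_dominates`), with inverse
`koszulHomotopy`; moreover a boundary never has terms in `C`, because generators are minimal
(`coeff_koszulDifferential_minGens`). Hence a cycle `c` without terms in `C` equals `∂ h c`: the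
difference is a cycle supported on `B`, and such a cycle vanishes. So reading off the coefficients in
`C` embeds the homology into `K^C`, and it is onto since `c - h ∂ c` is a cycle with the same
`C`-coefficients as `c`.

**The generators.** For `k_i = n - i` the generators of degree `ℓ_i` are the `w_i x_i x_j` with
`i ≤ j ≤ n - i + 1`, or one `tailGen` when this range is empty (`cornerGens_eq`). Comparing one
well-chosen exponent shows that no generator divides another, and an exchange `x_a u / x_b` of a
generator is divisible by an explicit `w_p x_p x_q`. The last variable of a generator of degree `ℓ_i`
is at most `x_{k_i + 1}`, and exactly one generator of that degree attains it. By the formula above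
`β_{k_i, k_i + ℓ_i} = 1`, and all nonzero `β_{c, c + j}` have `j = ℓ_i` and `c ≤ k_i` for some `i`;
since `k` decreases and `ℓ` increases, the corners are the pairs `(k_i, ℓ_i)`.
-/

noncomputable section

/-! ### Monomials in monomial and strongly stable ideals -/

section Monomials

variable {K : Type*} [Field K] {n : ℕ}

theorem mem_monomialIdeal_iff {A : Set (Fin n →₀ ℕ)} {f : MvPolynomial (Fin n) K} :
    f ∈ monomialIdeal K A ↔ ∀ m ∈ f.support, ∃ u ∈ A, u ≤ m :=
  mem_ideal_span_monomial_image

theorem monomial_mem_monomialIdeal_iff {A : Set (Fin n →₀ ℕ)} {m : Fin n →₀ ℕ} :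
    monomial m (1 : K) ∈ monomialIdeal K A ↔ ∃ u ∈ A, u ≤ m := by
  classical
  rw [mem_monomialIdeal_iff, support_monomial, if_neg one_ne_zero]
  simp

theorem minGens_monomialIdeal {A : Set (Fin n →₀ ℕ)} (hA : IsAntichain (· ≤ ·) A) :
    minGens (monomialIdeal K A) = A := by
  ext u
  simp only [minGens, monomial_mem_monomialIdeal_iff, Set.mem_ofPred_eq]
  constructor
  · rintro ⟨⟨v, hv, hvu⟩, h⟩
    rwa [← h v ⟨v, hv, le_rfl⟩ hvu]
  · refine fun hu => ⟨⟨u, hu, le_rfl⟩, ?_⟩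
    rintro v ⟨w, hw, hwv⟩ hvu
    have := hA.eq hw hu (hwv.trans hvu)
    exact le_antisymm hvu (this ▸ hwv)

theorem monomial_mem_of_le {I : Ideal (MvPolynomial (Fin n) K)} {m m' : Fin n →₀ ℕ}
    (hm : monomial m (1 : K) ∈ I) (h : m ≤ m') : monomial m' (1 : K) ∈ I := by
  have : monomial m' (1 : K) = monomial (m' - m) 1 * monomial m 1 := by
    rw [monomial_mul, tsub_add_cancel_of_le h, one_mul]
  rw [this]
  exact I.mul_mem_left _ hm

theorem exists_minGens_le {I : Ideal (MvPolynomial (Fin n) K)} {m : Fin n →₀ ℕ}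
    (hm : monomial m (1 : K) ∈ I) : ∃ u ∈ minGens I, u ≤ m := by
  obtain ⟨u, hum, hu⟩ :=
    exists_minimal_le_of_wellFoundedLT (fun v => monomial v (1 : K) ∈ I) m hm
  exact ⟨u, ⟨hu.prop, fun v hv hvu => le_antisymm hvu (hu.le_of_le hv hvu)⟩, hum⟩

theorem IsStronglyStable.mem_iff {I : Ideal (MvPolynomial (Fin n) K)} (hI : IsStronglyStable I)
    {f : MvPolynomial (Fin n) K} : f ∈ I ↔ ∀ m, coeff m f ≠ 0 → monomial m (1 : K) ∈ I := by
  obtain ⟨⟨A, rfl⟩, -⟩ := hI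
  simp only [mem_monomialIdeal_iff (f := f), monomial_mem_monomialIdeal_iff, mem_support_iff]

/-- The exchange property of the generators extends to all monomials of the ideal. -/
theorem IsStronglyStable.exchange {I : Ideal (MvPolynomial (Fin n) K)} (hI : IsStronglyStable I)
    {m : Fin n →₀ ℕ} (hm : monomial m (1 : K) ∈ I) {t a : Fin n} (ht : m t ≠ 0) (hat : a < t) :
    monomial (m - Finsupp.single t 1 + Finsupp.single a 1) (1 : K) ∈ I := by
  obtain ⟨u, hu, hum⟩ := exists_minGens_le hm
  by_cases hut : u t = 0
  · refine monomial_mem_of_le hu.1 (le_trans ?_ le_self_add)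
    intro b
    have := hum b
    by_cases hb : b = t
    · subst hb; simp [hut]
    · simpa [Finsupp.single_apply, Ne.symm hb] using this
  · refine monomial_mem_of_le (hI.2 u hu t (Finsupp.mem_support_iff.2 hut) a hat) ?_
    exact add_le_add_left (tsub_le_tsub_right hum _) _

/-- A monomial of a strongly stable ideal which is not a minimal generator stays in the ideal
after division by its last variable. -/
theorem IsStronglyStable.exists_last_div_mem {I : Ideal (MvPolynomial (Fin n) K)}
    (hI : IsStronglyStable I) {m : Fin n →₀ ℕ} (hm : monomial m (1 : K) ∈ I)
    (hmin : m ∉ minGens I) :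
    ∃ t, m t ≠ 0 ∧ (∀ a, m a ≠ 0 → a ≤ t) ∧ monomial (m - Finsupp.single t 1) (1 : K) ∈ I := by
  simp only [minGens, Set.mem_ofPred_eq, hm, true_and, not_forall] at hmin
  obtain ⟨v, hv, hvm, hne⟩ := hmin
  obtain ⟨b, hb⟩ : ∃ b, v b < m b := by
    by_contra! h
    exact hne (le_antisymm hvm h)
  have hb0 : m b ≠ 0 := by omega
  obtain ⟨t, ht, htmax⟩ : ∃ t ∈ m.support, ∀ a ∈ m.support, a ≤ t :=
    m.support.exists_max_image id ⟨b, Finsupp.mem_support_iff.2 hb0⟩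
  simp only [Finsupp.mem_support_iff] at ht htmax
  refine ⟨t, ht, htmax, ?_⟩
  have hdiv : monomial (m - Finsupp.single b 1) (1 : K) ∈ I := by
    refine monomial_mem_of_le hv fun c => ?_
    have := hvm c
    by_cases hc : c = b
    · subst hc; simp; omega
    · simpa [Finsupp.single_apply, Ne.symm hc] using this
  rcases (htmax b hb0).eq_or_lt with rfl | hbt
  · exact hdiv
  · have hbt' : b ≠ t := hbt.ne
    have := hI.exchange hdiv (t := t) (a := b) (by simpa [Finsupp.single_apply, hbt'] using ht) hbt
    have heq : m - Finsupp.single b 1 - Finsupp.single t 1 + Finsupp.single b 1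
        = m - Finsupp.single t 1 := by
      ext c
      by_cases hc : c = b
      · subst hc; simp [hbt'.symm]; omega
      · simp [Finsupp.single_apply, Ne.symm hc]
    rwa [heq] at this

end Monomials

/-! ### The Koszul differential on coefficients -/

section Koszul

variable {K : Type*} [Field K] {n : ℕ}

/-- The sign with which `e_τ` occurs in `∂ e_{τ ∪ {a}}`. -/
def koszulSign (K : Type*) [Field K] {n : ℕ} (τ : Finset (Fin n)) (a : Fin n) : K :=
  (-1) ^ (τ.filter (· < a)).card

theorem koszulSign_mul_self (τ : Finset (Fin n)) (a : Fin n) :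
    koszulSign K τ a * koszulSign K τ a = 1 := by
  rw [koszulSign, ← mul_pow]
  simp

theorem koszulSign_ne_zero (τ : Finset (Fin n)) (a : Fin n) : koszulSign K τ a ≠ 0 :=
  pow_ne_zero _ (by simp)

theorem koszulDifferential_apply (c : Finset (Fin n) → MvPolynomial (Fin n) K)
    (τ : Finset (Fin n)) :
    koszulDifferential K n c τ = ∑ a ∈ τᶜ, C (koszulSign K τ a) * (X a * c (insert a τ)) := by
  simp [koszulDifferential, koszulSign, mul_assoc]

theorem coeff_koszulDifferential (c : Finset (Fin n) → MvPolynomial (Fin n) K)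
    (τ : Finset (Fin n)) (m : Fin n →₀ ℕ) :
    coeff m (koszulDifferential K n c τ) = ∑ a ∈ τᶜ, koszulSign K τ a *
      if m a ≠ 0 then coeff (m - Finsupp.single a 1) (c (insert a τ)) else 0 := by
  classical
  rw [koszulDifferential_apply, coeff_sum]
  refine Finset.sum_congr rfl fun a _ => ?_
  rw [coeff_C_mul, coeff_X_mul']
  simp only [Finsupp.mem_support_iff]

theorem koszulSign_insert_of_lt {τ : Finset (Fin n)} {a b : Fin n} (ha : a ∉ τ) (hab : a < b) :
    koszulSign K τ a * koszulSign K (insert a τ) b =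
      -(koszulSign K τ b * koszulSign K (insert b τ) a) := by
  simp only [koszulSign]
  rw [Finset.filter_insert, if_pos hab, Finset.filter_insert, if_neg hab.le.not_gt,
    Finset.card_insert_of_notMem (by simp [ha])]
  ring

theorem koszulSign_insert_swap {τ : Finset (Fin n)} {a b : Fin n} (ha : a ∉ τ) (hb : b ∉ τ)
    (hab : a ≠ b) :
    koszulSign K τ a * koszulSign K (insert a τ) b =
      -(koszulSign K τ b * koszulSign K (insert b τ) a) := by
  rcases hab.lt_or_gt with h | h
  · exact koszulSign_insert_of_lt ha h
  · rw [koszulSign_insert_of_lt hb h, neg_neg]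

theorem koszulDifferential_comp_self (c : Finset (Fin n) → MvPolynomial (Fin n) K) :
    koszulDifferential K n (koszulDifferential K n c) = 0 := by
  funext τ
  simp only [koszulDifferential_apply, Finset.mul_sum, Pi.zero_apply]
  rw [Finset.sum_sigma']
  refine Finset.sum_involution (fun p _ => ⟨p.2, p.1⟩) ?_ ?_ ?_ ?_
  · rintro ⟨a, b⟩ h
    simp only [Finset.mem_sigma, Finset.mem_compl, Finset.mem_insert, not_or] at h
    have hs := koszulSign_insert_swap (K := K) h.1 h.2.2 (Ne.symm h.2.1)
    dsimp only
    rw [Finset.insert_comm b a τ]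
    generalize c (insert a (insert b τ)) = p
    calc _ = C (koszulSign K τ a * koszulSign K (insert a τ) b
          + koszulSign K τ b * koszulSign K (insert b τ) a) * (X a * (X b * p)) := by
          simp only [map_add, map_mul]; ring
      _ = 0 := by rw [hs]; simp
  · rintro ⟨a, b⟩ h _ heq
    simp only [Finset.mem_sigma, Finset.mem_compl, Finset.mem_insert, not_or] at h
    simp only [Sigma.mk.injEq, heq_eq_eq] at heq
    exact h.2.1 heq.1
  · rintro ⟨a, b⟩ h
    simp only [Finset.mem_sigma, Finset.mem_compl, Finset.mem_insert, not_or] at h ⊢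
    exact ⟨h.2.2, Ne.symm h.2.1, h.1⟩
  · rintro ⟨a, b⟩ _
    rfl

end Koszul

/-! ### The Eliahou–Kervaire formula -/

section EliahouKervaire

variable {K : Type*} [Field K] {n : ℕ}

/-- The index set `σ` has an element that is at least the index of every variable of `x^m`. -/
def Dominates (σ : Finset (Fin n)) (m : Fin n →₀ ℕ) : Prop :=
  ∃ t ∈ σ, ∀ a, m a ≠ 0 → a ≤ t

open Classical in
/-- The sum of the terms of `p` whose exponents satisfy `P`. -/
def restrictTerms (P : (Fin n →₀ ℕ) → Prop) (p : MvPolynomial (Fin n) K) :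
    MvPolynomial (Fin n) K :=
  ∑ m ∈ p.support with P m, monomial m (coeff m p)

open Classical in
theorem coeff_restrictTerms (P : (Fin n →₀ ℕ) → Prop) (p : MvPolynomial (Fin n) K)
    (m : Fin n →₀ ℕ) : coeff m (restrictTerms P p) = if P m then coeff m p else 0 := by
  simp only [restrictTerms, coeff_sum, coeff_monomial, Finset.sum_ite_eq', Finset.mem_filter,
    mem_support_iff]
  by_cases h : coeff m p = 0 <;> simp [h]

/-- The operator `x^m e_τ ↦ ± (x^m / x_t) e_{τ ∪ {t}}`, where `x_t` is the last variable of `x^m`,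
all elements of `τ` are less than `t`, and `x^m / x_t ∈ I`; the other `x^m e_τ` go to `0`. -/
def koszulHomotopy (I : Ideal (MvPolynomial (Fin n) K))
    (c : Finset (Fin n) → MvPolynomial (Fin n) K) (σ : Finset (Fin n)) :
    MvPolynomial (Fin n) K :=
  if h : σ.Nonempty then
    C (koszulSign K (σ.erase (σ.max' h)) (σ.max' h)) *
      restrictTerms (fun m => monomial m (1 : K) ∈ I ∧ ∀ a, m a ≠ 0 → a ≤ σ.max' h)
        ((c (σ.erase (σ.max' h))).divMonomial (Finsupp.single (σ.max' h) 1))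
  else 0

open Classical in
theorem coeff_koszulHomotopy (I : Ideal (MvPolynomial (Fin n) K))
    (c : Finset (Fin n) → MvPolynomial (Fin n) K) {σ : Finset (Fin n)} (h : σ.Nonempty)
    (m : Fin n →₀ ℕ) :
    coeff m (koszulHomotopy I c σ) =
      if monomial m (1 : K) ∈ I ∧ ∀ a, m a ≠ 0 → a ≤ σ.max' h then
        koszulSign K (σ.erase (σ.max' h)) (σ.max' h) *
          coeff (m + Finsupp.single (σ.max' h) 1) (c (σ.erase (σ.max' h))) else 0 := by
  rw [koszulHomotopy, dif_pos h, coeff_C_mul, coeff_restrictTerms, coeff_divMonomial, mul_ite,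
    mul_zero, add_comm]
  split_ifs <;> rfl

theorem koszulHomotopy_support {I : Ideal (MvPolynomial (Fin n) K)}
    {c : Finset (Fin n) → MvPolynomial (Fin n) K} {σ : Finset (Fin n)} {m : Fin n →₀ ℕ}
    (h : coeff m (koszulHomotopy I c σ) ≠ 0) :
    monomial m (1 : K) ∈ I ∧ Dominates σ m ∧
      ∃ t ∈ σ, coeff (m + Finsupp.single t 1) (c (σ.erase t)) ≠ 0 := by
  by_cases hσ : σ.Nonempty
  · rw [coeff_koszulHomotopy I c hσ] at h
    split_ifs at h with hm
    · exact ⟨hm.1, ⟨_, σ.max'_mem hσ, hm.2⟩, _, σ.max'_mem hσ, right_ne_zero_of_mul h⟩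
    · exact absurd rfl h
  · simp [koszulHomotopy, hσ] at h

/-- On chains supported on dominated terms, the coefficient of the boundary at an undominated
`x^m e_τ` comes from a single term. -/
theorem coeff_koszulDifferential_of_dominates {b : Finset (Fin n) → MvPolynomial (Fin n) K}
    (hb : ∀ σ m, coeff m (b σ) ≠ 0 → Dominates σ m) {τ : Finset (Fin n)} {m : Fin n →₀ ℕ}
    {t : Fin n} (hτ : ∀ a ∈ τ, a < t) (hmt : m t ≠ 0) (hm : ∀ a, m a ≠ 0 → a ≤ t) :
    coeff m (koszulDifferential K n b τ) =
      koszulSign K τ t * coeff (m - Finsupp.single t 1) (b (insert t τ)) := by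
  have htτ : t ∉ τ := fun h => (hτ t h).false
  rw [coeff_koszulDifferential, Finset.sum_eq_single t]
  · rw [if_pos hmt]
  · intro a _ hat
    split_ifs with ha
    · have hlt : a < t := lt_of_le_of_ne (hm a ha) hat
      refine mul_eq_zero_of_right _ (by_contra fun h => ?_)
      obtain ⟨s, hs, hs'⟩ := hb _ _ h
      have hts : t ≤ s := hs' t (by simpa [Finsupp.single_apply, hat] using hmt)
      rcases Finset.mem_insert.1 hs with rfl | hs
      · exact absurd hts hlt.not_ge
      · exact absurd hts (hτ s hs).not_ge
    · exact mul_zero _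
  · intro h
    exact absurd htτ (by simpa using h)

/-- Boundaries of chains with coefficients in `I` have no terms at minimal generators of `I`. -/
theorem coeff_koszulDifferential_minGens {I : Ideal (MvPolynomial (Fin n) K)}
    {b : Finset (Fin n) → MvPolynomial (Fin n) K}
    (hb : ∀ σ m, coeff m (b σ) ≠ 0 → monomial m (1 : K) ∈ I) (τ : Finset (Fin n))
    {u : Fin n →₀ ℕ} (hu : u ∈ minGens I) : coeff u (koszulDifferential K n b τ) = 0 := by
  rw [coeff_koszulDifferential]
  refine Finset.sum_eq_zero fun a _ => mul_eq_zero_of_right _ ?_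
  split_ifs with ha
  · by_contra h
    have := DFunLike.congr_fun (hu.2 _ (hb _ _ h) tsub_le_self) a
    simp at this
    omega
  · rfl

theorem koszulDifferential_mem {I : Ideal (MvPolynomial (Fin n) K)}
    {c : Finset (Fin n) → MvPolynomial (Fin n) K} (hc : ∀ σ, c σ ∈ I) (σ : Finset (Fin n)) :
    koszulDifferential K n c σ ∈ I := by
  rw [koszulDifferential_apply]
  exact I.sum_mem fun a _ => I.mul_mem_left _ (I.mul_mem_left _ (hc _))

/-- A cycle supported on dominated terms vanishes: its terms are recovered, up to sign, from the
undominated coefficients of its boundary. -/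
theorem eq_zero_of_dominates {c : Finset (Fin n) → MvPolynomial (Fin n) K}
    (hc : ∀ σ m, coeff m (c σ) ≠ 0 → Dominates σ m) (hd : koszulDifferential K n c = 0) :
    c = 0 := by
  funext σ
  ext m
  by_contra h
  rw [Pi.zero_apply, coeff_zero] at h
  obtain ⟨s, hs, hm⟩ := hc σ m h
  have hσ : σ.Nonempty := ⟨s, hs⟩
  have key := coeff_koszulDifferential_of_dominates hc (τ := σ.erase (σ.max' hσ))
    (m := m + Finsupp.single (σ.max' hσ) 1) (t := σ.max' hσ)
    (fun a ha => Finset.lt_max'_of_mem_erase_max' _ _ ha) (by simp) (fun a ha => by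
      by_cases hat : a = σ.max' hσ
      · exact hat.le
      · refine (hm a ?_).trans (σ.le_max' s hs)
        simpa [Finsupp.single_apply, Ne.symm hat] using ha)
  rw [hd, add_tsub_cancel_right, Finset.insert_erase (σ.max'_mem hσ)] at key
  simp only [Pi.zero_apply, coeff_zero] at key
  exact mul_ne_zero (koszulSign_ne_zero _ _) h key.symm

variable {I : Ideal (MvPolynomial (Fin n) K)}

/-- A cycle with coefficients in `I` is the boundary of its image under `koszulHomotopy`, as soon
as it has no undominated terms at minimal generators. -/
theorem IsStronglyStable.koszulDifferential_koszulHomotopy (hI : IsStronglyStable I)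
    {c : Finset (Fin n) → MvPolynomial (Fin n) K} (hc : ∀ σ, c σ ∈ I)
    (hd : koszulDifferential K n c = 0)
    (hmin : ∀ σ, ∀ u ∈ minGens I, ¬ Dominates σ u → coeff u (c σ) = 0) :
    koszulDifferential K n (koszulHomotopy I c) = c := by
  have hhI : ∀ σ m, coeff m (koszulHomotopy I c σ) ≠ 0 → monomial m (1 : K) ∈ I :=
    fun σ m h => (koszulHomotopy_support h).1
  refine (sub_eq_zero.1 (eq_zero_of_dominates (c := c - _) ?_ ?_)).symm
  · intro τ m h
    by_contra hdom
    rw [Pi.sub_apply, coeff_sub] at h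
    by_cases hm : m ∈ minGens I
    · rw [hmin τ m hm hdom, coeff_koszulDifferential_minGens hhI τ hm] at h
      simp at h
    · have hmI : monomial m (1 : K) ∈ I := by
        refine hI.mem_iff.1 (I.sub_mem (hc τ)
          (koszulDifferential_mem (c := koszulHomotopy I c) (fun σ => ?_) τ)) m (by simpa using h)
        exact hI.mem_iff.2 (hhI σ)
      obtain ⟨t, hmt, ht, hdiv⟩ := hI.exists_last_div_mem hmI hm
      have hτ : ∀ a ∈ τ, a < t := by
        intro a ha
        by_contra hat
        exact hdom ⟨a, ha, fun b hb => (ht b hb).trans (not_lt.1 hat)⟩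
      have hne : (insert t τ).Nonempty := Finset.insert_nonempty t τ
      have hmax : (insert t τ).max' hne = t := by
        refine le_antisymm (Finset.max'_le _ _ _ fun a ha => ?_)
          (Finset.le_max' _ _ (Finset.mem_insert_self _ _))
        rcases Finset.mem_insert.1 ha with rfl | ha
        exacts [le_rfl, (hτ a ha).le]
      have hle : Finsupp.single t 1 ≤ m := by
        rw [Finsupp.single_le_iff]; omega
      rw [coeff_koszulDifferential_of_dominates (fun σ m h => (koszulHomotopy_support h).2.1)
        hτ hmt ht, coeff_koszulHomotopy I c hne, hmax, if_pos, tsub_add_cancel_of_le hle,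
        Finset.erase_insert (fun h => (hτ t h).false), ← mul_assoc, koszulSign_mul_self,
        one_mul, sub_self] at h
      · exact h rfl
      · refine ⟨hdiv, fun a ha => ht a fun h0 => ha ?_⟩
        simp [h0]
  · rw [map_sub, hd, koszulDifferential_comp_self, sub_zero]

theorem IsStronglyStable.mem_koszulChains (hI : IsStronglyStable I) {i j : ℕ}
    {c : Finset (Fin n) → MvPolynomial (Fin n) K} :
    c ∈ koszulChains I i j ↔
      ∀ σ m, coeff m (c σ) ≠ 0 → monomial m (1 : K) ∈ I ∧ σ.card = i ∧ m.degree + i = j := by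
  change (∀ σ, c σ ∈ I ∧ ∀ m ∈ (c σ).support, σ.card = i ∧ m.degree + i = j) ↔ _
  simp only [mem_support_iff]
  exact ⟨fun h σ m hm => ⟨hI.mem_iff.1 (h σ).1 m hm, (h σ).2 m hm⟩,
    fun h σ => ⟨hI.mem_iff.2 fun m hm => (h σ m hm).1, fun m hm => (h σ m hm).2⟩⟩

/-- The Eliahou–Kervaire symbols of homological degree `i` and internal degree `j`: pairs of a
minimal generator `u` and an `i`-element set of indices of variables that all precede the last
variable of `u`. -/
def ekSymbols (I : Ideal (MvPolynomial (Fin n) K)) (i j : ℕ) :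
    Set ((Fin n →₀ ℕ) × Finset (Fin n)) :=
  {p | p.1 ∈ minGens I ∧ p.1.degree + i = j ∧ p.2.card = i ∧ ¬ Dominates p.2 p.1}

theorem finite_ekSymbols (I : Ideal (MvPolynomial (Fin n) K)) (i j : ℕ) :
    (ekSymbols I i j).Finite := by
  refine ((Finsupp.finite_of_degree_le j).prod Set.finite_univ).subset fun p hp => ?_
  refine Set.mem_prod.2 ⟨?_, Set.mem_univ _⟩
  have := hp.2.1
  change p.1.degree ≤ j
  omega

/-- The coefficients of a cycle at the Eliahou–Kervaire symbols. -/
def symbolCoeff (I : Ideal (MvPolynomial (Fin n) K)) (i j : ℕ) :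
    koszulCycles I i j →ₗ[K] (ekSymbols I i j → K) where
  toFun z p := coeff p.1.1 (z.1 p.1.2)
  map_add' z w := by funext p; simp
  map_smul' r z := by funext p; simp

theorem koszulHomotopy_mem_koszulChains (hI : IsStronglyStable I) {i j : ℕ}
    {c : Finset (Fin n) → MvPolynomial (Fin n) K} (hc : c ∈ koszulChains I i j) :
    koszulHomotopy I c ∈ koszulChains I (i + 1) j := by
  rw [hI.mem_koszulChains] at hc ⊢
  intro σ m h
  obtain ⟨hm, -, t, ht, h⟩ := koszulHomotopy_support h
  obtain ⟨-, h1, h2⟩ := hc _ _ h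
  rw [Finset.card_erase_of_mem ht] at h1
  have := Finset.card_pos.2 ⟨t, ht⟩
  rw [map_add, Finsupp.degree_single] at h2
  exact ⟨hm, by omega, by omega⟩

theorem koszulHomotopy_koszulDifferential_mem_koszulChains (hI : IsStronglyStable I) {i j : ℕ}
    {c : Finset (Fin n) → MvPolynomial (Fin n) K} (hc : c ∈ koszulChains I i j) :
    koszulHomotopy I (koszulDifferential K n c) ∈ koszulChains I i j := by
  rw [hI.mem_koszulChains] at hc ⊢
  intro σ m h
  obtain ⟨hm, -, t, ht, h⟩ := koszulHomotopy_support h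
  rw [coeff_koszulDifferential] at h
  obtain ⟨a, ha, h⟩ := Finset.exists_ne_zero_of_sum_ne_zero h
  have h := right_ne_zero_of_mul h
  split_ifs at h with hma
  · obtain ⟨-, h1, h2⟩ := hc _ _ h
    rw [Finset.card_insert_of_notMem (Finset.mem_compl.1 ha), Finset.card_erase_of_mem ht] at h1
    have := Finset.card_pos.2 ⟨t, ht⟩
    have hdeg : (m + Finsupp.single t 1 - Finsupp.single a 1).degree + 1 = m.degree + 1 := by
      have hle : Finsupp.single a 1 ≤ m + Finsupp.single t 1 := by
        rw [Finsupp.single_le_iff]; omega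
      have := congrArg Finsupp.degree (tsub_add_cancel_of_le hle)
      simpa only [map_add, Finsupp.degree_single] using this
    exact ⟨hm, by omega, by omega⟩
  · exact absurd rfl h

/-- A cycle is a boundary if and only if it has no terms at the Eliahou–Kervaire symbols. -/
theorem IsStronglyStable.ker_symbolCoeff (hI : IsStronglyStable I) (i j : ℕ) :
    LinearMap.ker (symbolCoeff I i j) =
      (koszulBoundaries I i j).comap (koszulCycles I i j).subtype := by
  ext ⟨z, hz, hdz⟩
  have hzI := hI.mem_koszulChains.1 hz
  rw [LinearMap.mem_ker, Submodule.mem_comap, Submodule.subtype_apply]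
  constructor
  · intro h
    refine ⟨_, koszulHomotopy_mem_koszulChains hI hz,
      hI.koszulDifferential_koszulHomotopy (fun σ => (hz σ).1) hdz fun σ u hu hdom => ?_⟩
    by_contra hne
    obtain ⟨-, h1, h2⟩ := hzI σ u hne
    exact hne (congrFun h ⟨(u, σ), hu, h2, h1, hdom⟩)
  · rintro ⟨b, hb, rfl⟩
    funext p
    exact coeff_koszulDifferential_minGens (fun σ m h => (hI.mem_koszulChains.1 hb σ m h).1) _
      p.2.1

theorem IsStronglyStable.symbolCoeff_surjective (hI : IsStronglyStable I) (i j : ℕ) :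
    Function.Surjective (symbolCoeff I i j) := by
  classical
  intro v
  have := (finite_ekSymbols I i j).fintype
  set c : Finset (Fin n) → MvPolynomial (Fin n) K :=
    ∑ p : ekSymbols I i j, Pi.single p.1.2 (monomial p.1.1 (v p)) with hcdef
  have hc : c ∈ koszulChains I i j := by
    refine Submodule.sum_mem _ fun p _ => hI.mem_koszulChains.2 fun σ m h => ?_
    have hσ : σ = p.1.2 := by
      by_contra hne
      simp [hne] at h
    subst hσ
    rw [Pi.single_eq_same, coeff_monomial] at h
    have hm : p.1.1 = m := by
      by_contra hne
      simp [hne] at h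
    exact hm ▸ ⟨p.2.1.1, p.2.2.2.1, p.2.2.1⟩
  have hcv : ∀ p : ekSymbols I i j, coeff p.1.1 (c p.1.2) = v p := by
    intro p
    rw [hcdef, Finset.sum_apply, coeff_sum, Finset.sum_eq_single p]
    · simp
    · intro q _ hqp
      by_cases hσ : p.1.2 = q.1.2
      · have : q.1.1 ≠ p.1.1 := fun h => hqp (Subtype.ext (Prod.ext h hσ.symm))
        rw [hσ, Pi.single_eq_same, coeff_monomial, if_neg this]
      · rw [Pi.single_eq_of_ne hσ, coeff_zero]
    · simp
  have hcI := hI.mem_koszulChains.1 hc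
  have hh : koszulDifferential K n (koszulHomotopy I (koszulDifferential K n c)) =
      koszulDifferential K n c :=
    hI.koszulDifferential_koszulHomotopy (koszulDifferential_mem fun σ => (hc σ).1)
      (koszulDifferential_comp_self c)
      fun σ u hu _ => coeff_koszulDifferential_minGens (fun σ m h => (hcI σ m h).1) σ hu
  refine ⟨⟨c - koszulHomotopy I (koszulDifferential K n c),
    Submodule.sub_mem _ hc (koszulHomotopy_koszulDifferential_mem_koszulChains hI hc), ?_⟩, ?_⟩
  · change koszulDifferential K n _ = 0
    rw [map_sub, hh, sub_self]
  · funext p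
    have h0 : coeff p.1.1 (koszulHomotopy I (koszulDifferential K n c) p.1.2) = 0 := by
      by_contra h
      exact p.2.2.2.2 (koszulHomotopy_support h).2.1
    change coeff p.1.1 ((c - koszulHomotopy I (koszulDifferential K n c)) p.1.2) = v p
    rw [Pi.sub_apply, coeff_sub, h0, sub_zero, hcv]

/-- The Eliahou–Kervaire formula: the graded Betti numbers of a strongly stable ideal count the
Eliahou–Kervaire symbols. -/
theorem IsStronglyStable.gradedBetti_eq (hI : IsStronglyStable I) (i j : ℕ) :
    gradedBetti I i j = (ekSymbols I i j).ncard := by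
  have := (finite_ekSymbols I i j).fintype
  rw [gradedBetti, (Submodule.quotEquivOfEq _ _ (hI.ker_symbolCoeff i j).symm).finrank_eq,
    ((symbolCoeff I i j).quotKerEquivOfSurjective (hI.symbolCoeff_surjective i j)).finrank_eq,
    Module.finrank_fintype_fun_eq_card, Set.ncard_eq_toFinset_card', Set.toFinset_card]

end EliahouKervaire

/-! ### Lexicographic segments -/

section Segments

variable {n : ℕ}

theorem eq_of_le_of_degree_le {u v : Fin n →₀ ℕ} (h : u ≤ v) (hd : v.degree ≤ u.degree) :
    u = v := by
  have := congrArg Finsupp.degree (tsub_add_cancel_of_le h)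
  rw [map_add] at this
  have h0 : v - u = 0 := (Finsupp.degree_eq_zero_iff _).1 (by omega)
  exact le_antisymm h (tsub_eq_zero_iff_le.1 h0)

theorem expVar_apply (j : ℕ) (a : Fin n) : expVar n j a = if (a : ℕ) + 1 = j then 1 else 0 :=
  rfl

theorem expVar_succ (a : Fin n) : expVar n (a + 1) = Finsupp.single a 1 := by
  ext b
  simp only [expVar_apply, Finsupp.single_apply, Fin.ext_iff, Nat.add_right_cancel_iff]
  exact if_congr eq_comm rfl rfl

theorem exists_expVar_eq_single {j : ℕ} (h1 : 1 ≤ j) (hj : j ≤ n) :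
    ∃ a : Fin n, (a : ℕ) + 1 = j ∧ expVar n j = Finsupp.single a 1 := by
  have ha : (⟨j - 1, by omega⟩ : Fin n).1 + 1 = j := Nat.sub_add_cancel h1
  exact ⟨⟨j - 1, by omega⟩, ha, by rw [← expVar_succ, ha]⟩

theorem degree_expVar {j : ℕ} (h1 : 1 ≤ j) (hj : j ≤ n) : (expVar n j).degree = 1 := by
  obtain ⟨a, -, h⟩ := exists_expVar_eq_single h1 hj
  rw [h, Finsupp.degree_single]

/-- The entries below `p` of a monomial lying lexicographically between two monomials with the
same entries below `p` are those of the two monomials. -/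
theorem eq_below_of_lex_between {u v z : Fin n →₀ ℕ} {p : Fin n} (hvz : toLex v ≤ toLex z)
    (hzu : toLex z ≤ toLex u) (h : ∀ c < p, v c = u c) :
    (∀ c < p, z c = v c) ∧ v p ≤ z p := by
  rcases hvz.eq_or_lt with hvz | hvz
  · obtain rfl : v = z := hvz
    exact ⟨fun _ _ => rfl, le_rfl⟩
  obtain ⟨q, hq, hvq⟩ := Finsupp.Lex.lt_iff.1 hvz
  simp only [ofLex_toLex] at hq hvq
  suffices hpq : p ≤ q by
    refine ⟨fun c hc => (hq c (hc.trans_le hpq)).symm, ?_⟩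
    rcases hpq.eq_or_lt with rfl | hlt
    exacts [hvq.le, (hq p hlt).le]
  by_contra hlt
  rw [not_le] at hlt
  have huq := h q hlt
  rcases hzu.eq_or_lt with hzu | hzu
  · obtain rfl : z = u := hzu
    omega
  obtain ⟨r, hr, hzr⟩ := Finsupp.Lex.lt_iff.1 hzu
  simp only [ofLex_toLex] at hr hzr
  rcases lt_trichotomy r q with hrq | rfl | hrq
  · have := hq r hrq
    have := h r (hrq.trans hlt)
    omega
  · omega
  · have := hr q hrq
    omega

theorem toLex_add_le_toLex_add_iff {w u v : Fin n →₀ ℕ} :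
    toLex (w + u) ≤ toLex (w + v) ↔ toLex u ≤ toLex v := by
  rw [toLex_add, toLex_add, add_le_add_iff_left]

/-- If `w` involves only `x_1, …, x_i`, the segment from `w x_i ^ 2` to `w x_i x_m` consists of the
`w x_i x_j` with `i ≤ j ≤ m`. -/
theorem lexSegment_eq {w : Fin n →₀ ℕ} {i m : ℕ} (hi : 1 ≤ i) (him : i ≤ m) (hm : m ≤ n)
    (hw : ∀ a : Fin n, i < a + 1 → w a = 0) :
    lexSegment (w + 2 • expVar n i) (w + expVar n i + expVar n m) =
      {z | ∃ j, i ≤ j ∧ j ≤ m ∧ z = w + expVar n i + expVar n j} := by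
  obtain ⟨p, hp, hpe⟩ := exists_expVar_eq_single hi (him.trans hm)
  obtain ⟨q, hq, hqe⟩ := exists_expVar_eq_single (hi.trans him) hm
  rw [two_smul, ← add_assoc]
  ext z
  simp only [lexSegment, Set.mem_ofPred_eq]
  constructor
  · rintro ⟨hdeg, hvz, hzu⟩
    have hagree := eq_below_of_lex_between (p := p) hvz hzu (fun c hc => by
      have h1 : (c : ℕ) + 1 ≠ i := by have : (c : ℕ) < p := hc; omega
      have h2 : (c : ℕ) + 1 ≠ m := by have : (c : ℕ) < p := hc; omega
      simp [expVar_apply, h1, h2])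
    have hle : w + expVar n i ≤ z := by
      intro c
      rcases lt_trichotomy c p with hc | rfl | hc
      · rw [hagree.1 c hc]
        exact Nat.le_add_right _ _
      · exact (Nat.le_add_right _ _).trans hagree.2
      · have hc' : (p : ℕ) < c := hc
        simp [expVar_apply, hw c (by omega), show (c : ℕ) + 1 ≠ i by omega]
    have hz := add_tsub_cancel_of_le hle
    set y := z - (w + expVar n i) with hy
    have hydeg : y.degree = 1 := by
      have := congrArg Finsupp.degree hz
      simp only [map_add, degree_expVar hi (him.trans hm)] at this hdeg
      omega
    obtain ⟨c, hc⟩ : ∃ c, y c ≠ 0 := by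
      by_contra! h
      have : y = 0 := Finsupp.ext h
      rw [this] at hydeg
      simp at hydeg
    have hyc : Finsupp.single c 1 = y := by
      refine eq_of_le_of_degree_le ?_ (by rw [Finsupp.degree_single]; omega)
      rw [Finsupp.single_le_iff]
      omega
    rw [← hz, ← hyc] at hvz hzu
    have h1 := toLex_add_le_toLex_add_iff.1 hvz
    have h2 := toLex_add_le_toLex_add_iff.1 hzu
    rw [hqe, Finsupp.Lex.single_le_iff] at h1
    rw [hpe, Finsupp.Lex.single_le_iff] at h2
    have h1' : (c : ℕ) ≤ q := h1
    have h2' : (p : ℕ) ≤ c := h2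
    exact ⟨c + 1, by omega, by omega, by rw [← hz, ← hyc, expVar_succ]⟩
  · rintro ⟨j, hij, hjm, rfl⟩
    obtain ⟨c, hc, hce⟩ := exists_expVar_eq_single (hi.trans hij) (hjm.trans hm)
    refine ⟨?_, ?_, ?_⟩
    · simp only [map_add, degree_expVar hi (him.trans hm),
        degree_expVar (hi.trans hij) (hjm.trans hm)]
    · rw [hqe, hce]
      refine toLex_add_le_toLex_add_iff.2 (Finsupp.Lex.single_le_iff.2 ?_)
      change (c : ℕ) ≤ q
      omega
    · rw [hpe, hce]
      refine toLex_add_le_toLex_add_iff.2 (Finsupp.Lex.single_le_iff.2 ?_)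
      change (p : ℕ) ≤ c
      omega

end Segments

/-! ### The generators of the explicit ideal -/

section Generators

variable {n : ℕ} {ℓ : ℕ → ℕ}

/-- The monomial `w_i x_i x_j`, where `w_i` is `stepMonomial n ℓ i`. -/
def lexGen (n : ℕ) (ℓ : ℕ → ℕ) (i j : ℕ) : Fin n →₀ ℕ :=
  stepMonomial n ℓ i + expVar n i + expVar n j

/-- The monomial `w_{k-1} x_k ^ (ℓ_k - ℓ_{k-1} - 1) x_{k+1} ^ (3 + ℓ_i - ℓ_k)` with `k = n - i`. -/
def tailGen (n : ℕ) (ℓ : ℕ → ℕ) (i : ℕ) : Fin n →₀ ℕ :=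
  stepMonomial n ℓ (n - i - 1) + (ℓ (n - i) - ℓ (n - i - 1) - 1) • expVar n (n - i) +
    (3 + ℓ i - ℓ (n - i)) • expVar n (n - i + 1)

/-- The generators of degree `ℓ_i` when `k_i = n - i`. The segment `w_i x_i ^ 2, …,
w_i x_i x_{n - i + 1}` is used as long as it is nonempty. -/
def stepGens (n : ℕ) (ℓ : ℕ → ℕ) (i : ℕ) : Set (Fin n →₀ ℕ) :=
  {u | (∃ j, i ≤ j ∧ i + j ≤ n + 1 ∧ u = lexGen n ℓ i j) ∨ (n + 1 < 2 * i ∧ u = tailGen n ℓ i)}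

theorem stepMonomial_apply (i : ℕ) (a : Fin n) :
    stepMonomial n ℓ i a = if 1 ≤ (a : ℕ) ∧ (a : ℕ) + 1 ≤ i then ℓ (a + 1) - ℓ a else 0 := by
  simp only [stepMonomial, Finsupp.finsetSum_apply, Finsupp.smul_apply, expVar_apply, smul_eq_mul,
    mul_ite, mul_one, mul_zero, Finset.sum_ite_eq, Finset.mem_Icc]
  refine if_congr (by omega) rfl rfl

theorem lexGen_apply (i j : ℕ) (a : Fin n) :
    lexGen n ℓ i j a = (if 1 ≤ (a : ℕ) ∧ (a : ℕ) + 1 ≤ i then ℓ (a + 1) - ℓ a else 0) +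
      (if (a : ℕ) + 1 = i then 1 else 0) + (if (a : ℕ) + 1 = j then 1 else 0) := by
  simp [lexGen, stepMonomial_apply, expVar_apply]

theorem tailGen_apply (i : ℕ) (a : Fin n) :
    tailGen n ℓ i a = (if 1 ≤ (a : ℕ) ∧ (a : ℕ) + 1 ≤ n - i - 1 then ℓ (a + 1) - ℓ a else 0) +
      (if (a : ℕ) + 1 = n - i then ℓ (n - i) - ℓ (n - i - 1) - 1 else 0) +
      (if (a : ℕ) + 1 = n - i + 1 then 3 + ℓ i - ℓ (n - i) else 0) := by
  simp [tailGen, stepMonomial_apply, expVar_apply]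

/-- A strictly decreasing sequence of `n - 2` integers between `2` and `n - 1` is
`n - 1, n - 2, …, 2`. -/
theorem eq_sub_of_strictAntiOn {k : ℕ → ℕ} (hk_le : k 1 ≤ n - 1)
    (hk : StrictAntiOn k (Set.Icc 1 (n - 2))) (hk_ge : 2 ≤ k (n - 2)) :
    ∀ i ∈ Set.Icc 1 (n - 2), k i = n - i := by
  have hanti : ∀ i, 1 ≤ i → i + 1 ≤ n - 2 → k (i + 1) < k i := fun i h1 h2 =>
    hk (Set.mem_Icc.2 ⟨h1, by omega⟩) (Set.mem_Icc.2 ⟨by omega, h2⟩) (Nat.lt_succ_self i)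
  have hup : ∀ i, 1 ≤ i → i ≤ n - 2 → k i + i ≤ n := by
    intro i h1
    induction i, h1 using Nat.le_induction with
    | base => intro h; omega
    | succ i h1 ih =>
      intro h
      have := hanti i h1 h
      have := ih (by omega)
      omega
  have hdown : ∀ m, m + 1 ≤ n - 2 → m + 2 ≤ k (n - 2 - m) := by
    intro m
    induction m with
    | zero => intro _; simpa using hk_ge
    | succ m ih =>
      intro h
      have h1 := hanti (n - 2 - (m + 1)) (by omega) (by omega)
      rw [show n - 2 - (m + 1) + 1 = n - 2 - m by omega] at h1
      have := ih (by omega)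
      omega
  intro i hi
  obtain ⟨h1, h2⟩ := Set.mem_Icc.1 hi
  have h3 := hup i h1 h2
  have h4 := hdown (n - 2 - i) (by omega)
  rw [show n - 2 - (n - 2 - i) = i by omega] at h4
  omega

theorem le_lastLexIndex_iff {k : ℕ → ℕ} (hk : ∀ i ∈ Set.Icc 1 (n - 2), k i = n - i) {i : ℕ}
    (hi : i ∈ Set.Icc 1 (n - 2)) : i ≤ lastLexIndex (n - 2) k ↔ 2 * i ≤ n + 1 := by
  obtain ⟨h1, h2⟩ := Set.mem_Icc.1 hi
  rw [lastLexIndex, Finset.le_sup_iff (by rw [Nat.bot_eq_zero]; omega)]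
  simp only [Finset.mem_filter, Finset.mem_Icc, id]
  constructor
  · rintro ⟨j, ⟨hj, hjk⟩, hij⟩
    rw [hk j (Set.mem_Icc.2 hj)] at hjk
    omega
  · intro h
    refine ⟨i, ⟨⟨h1, h2⟩, ?_⟩, le_rfl⟩
    rw [hk i hi]
    omega

theorem cornerGens_eq {k : ℕ → ℕ} (hk : ∀ i ∈ Set.Icc 1 (n - 2), k i = n - i) {i : ℕ}
    (hi : i ∈ Set.Icc 1 (n - 2)) : cornerGens n (n - 2) k ℓ i = stepGens n ℓ i := by
  obtain ⟨h1, h2⟩ := Set.mem_Icc.1 hi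
  have hseg : 2 * i ≤ n + 1 → lexSegment (stepMonomial n ℓ i + 2 • expVar n i)
      (stepMonomial n ℓ i + expVar n i + expVar n (k i + 1)) = stepGens n ℓ i := by
    intro h
    rw [lexSegment_eq h1 (by rw [hk i hi]; omega) (by rw [hk i hi]; omega)
      (fun a ha => by rw [stepMonomial_apply, if_neg (by omega)]), hk i hi]
    ext u
    simp only [stepGens, lexGen, Set.mem_ofPred_eq]
    constructor
    · rintro ⟨j, hj, hj', rfl⟩
      exact Or.inl ⟨j, hj, by omega, rfl⟩
    · rintro (⟨j, hj, hj', rfl⟩ | ⟨h', -⟩)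
      · exact ⟨j, hj, by omega, rfl⟩
      · omega
  unfold cornerGens
  split_ifs with hi1 hs
  · subst hi1
    have h0 : stepMonomial n ℓ 1 = 0 := by simp [stepMonomial]
    simpa [h0] using hseg (by omega)
  · exact hseg ((le_lastLexIndex_iff hk hi).1 hs)
  · rw [le_lastLexIndex_iff hk hi, not_le] at hs
    rw [hk i hi]
    ext u
    simp only [stepGens, Set.mem_ofPred_eq, Set.mem_singleton_iff]
    constructor
    · exact fun h => Or.inr ⟨hs, h⟩
    · rintro (⟨j, hj, hj', -⟩ | ⟨-, h⟩)
      · omega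
      · exact h

end Generators

/-! ### Divisibility and exchanges between the generators -/

section GeneratorProperties

variable {n : ℕ} {ℓ : ℕ → ℕ}

theorem two_le_of_strictMonoOn (hℓ_one : ℓ 1 = 2) (hℓ : StrictMonoOn ℓ (Set.Icc 1 (n - 2)))
    {i : ℕ} (h1 : 1 ≤ i) (h2 : i ≤ n - 2) : 2 ≤ ℓ i := by
  rw [← hℓ_one]
  exact hℓ.monotoneOn (Set.mem_Icc.2 ⟨le_rfl, by omega⟩) (Set.mem_Icc.2 ⟨h1, h2⟩) h1

theorem degree_stepMonomial (hℓ_one : ℓ 1 = 2) (hℓ : StrictMonoOn ℓ (Set.Icc 1 (n - 2))) {i : ℕ}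
    (h1 : 1 ≤ i) (h2 : i ≤ n - 2) : (stepMonomial n ℓ i).degree + 2 = ℓ i := by
  induction i, h1 using Nat.le_induction with
  | base => simp [stepMonomial, hℓ_one]
  | succ i h1 ih =>
    have ih := ih (by omega)
    have hlt : ℓ i < ℓ (i + 1) :=
      hℓ (Set.mem_Icc.2 ⟨h1, by omega⟩) (Set.mem_Icc.2 ⟨by omega, h2⟩) (Nat.lt_succ_self i)
    have hsum : stepMonomial n ℓ (i + 1) =
        stepMonomial n ℓ i + (ℓ (i + 1) - ℓ i) • expVar n (i + 1) :=
      Finset.sum_Icc_succ_top (by omega) _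
    rw [hsum, map_add, map_nsmul, degree_expVar (by omega) (by omega), smul_eq_mul]
    omega

theorem degree_of_mem_stepGens (hℓ_one : ℓ 1 = 2) (hℓ : StrictMonoOn ℓ (Set.Icc 1 (n - 2)))
    {i : ℕ} (hi : i ∈ Set.Icc 1 (n - 2)) {u : Fin n →₀ ℕ} (hu : u ∈ stepGens n ℓ i) :
    u.degree = ℓ i := by
  obtain ⟨h1, h2⟩ := Set.mem_Icc.1 hi
  rcases hu with ⟨j, hj, hj', rfl⟩ | ⟨h, rfl⟩
  · have := degree_stepMonomial hℓ_one hℓ h1 h2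
    simp only [lexGen, map_add, degree_expVar h1 (by omega : i ≤ n),
      degree_expVar (h1.trans hj) (by omega : j ≤ n)]
    omega
  · have := degree_stepMonomial hℓ_one hℓ (i := n - i - 1) (by omega) (by omega)
    have hlt : ℓ (n - i - 1) < ℓ (n - i) :=
      hℓ (Set.mem_Icc.2 ⟨by omega, by omega⟩) (Set.mem_Icc.2 ⟨by omega, by omega⟩) (by omega)
    have hlt' : ℓ (n - i) < ℓ i :=
      hℓ (Set.mem_Icc.2 ⟨by omega, by omega⟩) (Set.mem_Icc.2 ⟨by omega, by omega⟩) (by omega)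
    simp only [tailGen, map_add, map_nsmul, smul_eq_mul,
      degree_expVar (by omega : 1 ≤ n - i) (by omega : n - i ≤ n),
      degree_expVar (by omega : 1 ≤ n - i + 1) (by omega : n - i + 1 ≤ n)]
    omega

/-- A generator of degree `ℓ_i` does not divide a generator of degree `ℓ_{i'}` for `i < i'`. -/
theorem exists_lt_of_mem_stepGens (hℓ : StrictMonoOn ℓ (Set.Icc 1 (n - 2))) {i i' : ℕ}
    (h1 : 1 ≤ i) (hlt : i < i') (h2 : i' ≤ n - 2) {u v : Fin n →₀ ℕ} (hu : u ∈ stepGens n ℓ i)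
    (hv : v ∈ stepGens n ℓ i') : ∃ a, v a < u a := by
  rcases hv with ⟨j', hj', hij', rfl⟩ | ⟨h', rfl⟩
  -- the exponent of `x_i` is smaller in `w_{i'}` than in `w_i x_i`
  · rcases hu with ⟨j, hj, hij, rfl⟩ | ⟨h, rfl⟩
    · refine ⟨⟨i - 1, by omega⟩, ?_⟩
      rw [lexGen_apply, lexGen_apply]
      dsimp only
      split_ifs <;> omega
    · omega
  · obtain ⟨p, hp⟩ : ∃ p, n - i' = p + 1 := ⟨n - i' - 1, by omega⟩
    have hdp : ℓ p < ℓ (p + 1) :=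
      hℓ (Set.mem_Icc.2 ⟨by omega, by omega⟩) (Set.mem_Icc.2 ⟨by omega, by omega⟩) (by omega)
    by_cases hip : i < p + 1
    · rcases hu with ⟨j, hj, hij, rfl⟩ | ⟨h, rfl⟩
      · refine ⟨⟨i - 1, by omega⟩, ?_⟩
        rw [lexGen_apply, tailGen_apply]
        dsimp only
        rw [hp]
        split_ifs <;> omega
      · omega
    -- the exponent of `x_{n-i'}` is one less in the tail generator than in `w_i`
    · refine ⟨⟨p, by omega⟩, ?_⟩
      rw [tailGen_apply, hp]
      rcases hu with ⟨j, hj, hij, rfl⟩ | ⟨h, rfl⟩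
      · rw [lexGen_apply]
        dsimp only
        rw [Nat.add_sub_cancel]
        split_ifs <;> omega
      · rw [tailGen_apply]
        dsimp only
        rw [Nat.add_sub_cancel]
        split_ifs <;> omega

theorem isAntichain_iUnion_stepGens (hℓ_one : ℓ 1 = 2)
    (hℓ : StrictMonoOn ℓ (Set.Icc 1 (n - 2))) :
    IsAntichain (· ≤ ·) (⋃ i ∈ Set.Icc 1 (n - 2), stepGens n ℓ i) := by
  intro u hu v hv hne hle
  simp only [Set.mem_iUnion, exists_prop] at hu hv
  obtain ⟨i, hi, hu⟩ := hu
  obtain ⟨i', hi', hv⟩ := hv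
  have hdu := degree_of_mem_stepGens hℓ_one hℓ hi hu
  have hdv := degree_of_mem_stepGens hℓ_one hℓ hi' hv
  have hdeg : u.degree ≤ v.degree := Finsupp.degree_mono hle
  rw [hdu, hdv, hℓ.le_iff_le hi hi'] at hdeg
  rcases hdeg.eq_or_lt with rfl | hlt
  · exact hne (eq_of_le_of_degree_le hle (by rw [hdu, hdv]))
  · obtain ⟨a, ha⟩ := exists_lt_of_mem_stepGens hℓ hi.1 hlt hi'.2 hu hv
    exact absurd (hle a) ha.not_ge

/-- The variable `x_{a+1}` gained in an exchange supplies the factor `x_p` of `w_p x_p x_q`,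
`p = a + 1`; the rest has to be present in `u / x_b`. -/
theorem lexGen_le_exchange {u : Fin n →₀ ℕ} {a b q : Fin n} (hab : a < b) (haq : a < q)
    (hu : ∀ c ≤ a, stepMonomial n ℓ (a + 1) c ≤ u c) (huq : u q ≠ 0)
    (hbq : q = b → 2 ≤ u q) :
    lexGen n ℓ (a + 1) (q + 1) ≤ u - Finsupp.single b 1 + Finsupp.single a 1 := by
  intro c
  rw [lexGen, expVar_succ, expVar_succ, add_right_comm, Finsupp.add_apply, Finsupp.add_apply _ _ c]
  refine add_le_add_left ?_ _
  rw [Finsupp.tsub_apply, Finsupp.single_apply, Finsupp.single_apply]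
  rcases le_or_gt c a with hca | hca
  · rw [if_neg (hca.trans_lt haq).ne', if_neg (hca.trans_lt hab).ne']
    exact hu c hca
  · have hca' : (a : ℕ) < c := hca
    rw [stepMonomial_apply, if_neg (by omega)]
    by_cases hqc : q = c
    · subst hqc
      by_cases hbq' : b = q
      · have := hbq hbq'.symm
        simp only [hbq', if_true]
        omega
      · simp only [hbq', if_true, if_false]
        omega
    · simp [hqc]

/-- Every exchange `x_a u / x_b`, `a < b`, of a generator `u` is divisible by a generator. -/
theorem exists_stepGens_le_exchange (hℓ : StrictMonoOn ℓ (Set.Icc 1 (n - 2))) {i : ℕ}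
    (hi : i ∈ Set.Icc 1 (n - 2)) {u : Fin n →₀ ℕ} (hu : u ∈ stepGens n ℓ i) {a b : Fin n}
    (hb : u b ≠ 0) (hab : a < b) :
    ∃ i' ∈ Set.Icc 1 (n - 2), ∃ v ∈ stepGens n ℓ i',
      v ≤ u - Finsupp.single b 1 + Finsupp.single a 1 := by
  obtain ⟨h1, h2⟩ := Set.mem_Icc.1 hi
  have hab' : (a : ℕ) < b := hab
  have hstep : ∀ c : ℕ, 1 ≤ c → c + 1 ≤ n - 2 → ℓ c < ℓ (c + 1) := fun c h1 h2 =>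
    hℓ (Set.mem_Icc.2 ⟨h1, by omega⟩) (Set.mem_Icc.2 ⟨by omega, h2⟩) (Nat.lt_succ_self c)
  rcases hu with ⟨j, hj, hij, rfl⟩ | ⟨h, rfl⟩
  · by_cases hai : i ≤ a + 1
    · obtain rfl : (b : ℕ) + 1 = j := by
        rw [lexGen_apply] at hb
        split_ifs at hb <;> omega
      refine ⟨i, hi, lexGen n ℓ i (a + 1), Or.inl ⟨_, hai, by omega, rfl⟩, ?_⟩
      rw [lexGen, lexGen, expVar_succ, expVar_succ, add_tsub_cancel_right]
    · obtain ⟨q, hq⟩ : ∃ q : Fin n, (q : ℕ) + 1 = i := ⟨⟨i - 1, by omega⟩, Nat.sub_add_cancel h1⟩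
      have hq2 : 2 ≤ lexGen n ℓ i j q := by
        have := hstep q (by omega) (by omega)
        rw [lexGen_apply, if_pos (by omega), if_pos hq]
        omega
      refine ⟨a + 1, Set.mem_Icc.2 ⟨by omega, by omega⟩, lexGen n ℓ (a + 1) (q + 1),
        Or.inl ⟨_, by omega, by omega, rfl⟩,
        lexGen_le_exchange hab (Fin.lt_def.2 (by omega)) (fun c hc => ?_) (by omega)
          fun _ => hq2⟩
      have hc' : (c : ℕ) ≤ a := hc
      rw [stepMonomial_apply, lexGen_apply]
      split_ifs <;> omega
  · obtain ⟨p, hp⟩ : ∃ p, n - i = p + 1 := ⟨n - i - 1, by omega⟩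
    have hle : ℓ (p + 1 + 1) ≤ ℓ i :=
      hℓ.monotoneOn (Set.mem_Icc.2 ⟨by omega, by omega⟩) hi (by omega)
    have hp0 := hstep p (by omega) (by omega)
    have hp1 := hstep (p + 1) (by omega) (by omega)
    have hbp : (b : ℕ) ≤ p + 1 := by
      rw [tailGen_apply, hp, Nat.add_sub_cancel] at hb
      split_ifs at hb <;> omega
    by_cases hap : (a : ℕ) = p
    · have hbp' : (b : ℕ) = p + 1 := by omega
      refine ⟨p + 2, Set.mem_Icc.2 ⟨by omega, by omega⟩, lexGen n ℓ (p + 2) (p + 2),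
        Or.inl ⟨_, le_rfl, by omega, rfl⟩, fun c => ?_⟩
      rw [Finsupp.add_apply, Finsupp.tsub_apply, Finsupp.single_apply, Finsupp.single_apply,
        lexGen_apply, tailGen_apply, hp, Nat.add_sub_cancel]
      simp only [Fin.ext_iff, hap, hbp']
      rcases lt_trichotomy (c : ℕ) p with hc | hc | hc
      · split_ifs <;> omega
      · simp only [hc]
        split_ifs <;> omega
      · by_cases hc' : (c : ℕ) = p + 1
        · simp only [hc']
          split_ifs <;> omega
        · rw [if_neg (by omega), if_neg (by omega)]
          exact Nat.zero_le _
    · obtain ⟨q, hq⟩ : ∃ q : Fin n, (q : ℕ) = p + 1 := ⟨⟨p + 1, by omega⟩, rfl⟩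
      have hq2 : 2 ≤ tailGen n ℓ i q := by
        rw [tailGen_apply, hp, if_pos (by omega : (q : ℕ) + 1 = p + 1 + 1)]
        omega
      refine ⟨a + 1, Set.mem_Icc.2 ⟨by omega, by omega⟩, lexGen n ℓ (a + 1) (q + 1),
        Or.inl ⟨_, by omega, by omega, rfl⟩,
        lexGen_le_exchange hab (Fin.lt_def.2 (by omega)) (fun c hc => ?_) (by omega)
          fun _ => hq2⟩
      have hc' : (c : ℕ) ≤ a := hc
      rw [stepMonomial_apply, tailGen_apply, hp, Nat.add_sub_cancel]
      split_ifs <;> omega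

/-- The generators of degree `ℓ_i` involve only `x_1, …, x_{n - i + 1}`. -/
theorem le_of_mem_stepGens {i : ℕ} (hi : i ≤ n) {u : Fin n →₀ ℕ} (hu : u ∈ stepGens n ℓ i)
    {b : Fin n} (hb : u b ≠ 0) : (b : ℕ) + i ≤ n := by
  rcases hu with ⟨j, hj, hij, rfl⟩ | ⟨h, rfl⟩
  · rw [lexGen_apply] at hb
    split_ifs at hb <;> omega
  · rw [tailGen_apply] at hb
    split_ifs at hb <;> omega

/-- The generator of degree `ℓ_i` that involves `x_{n - i + 1}`. -/
def topGen (n : ℕ) (ℓ : ℕ → ℕ) (i : ℕ) : Fin n →₀ ℕ :=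
  if 2 * i ≤ n + 1 then lexGen n ℓ i (n + 1 - i) else tailGen n ℓ i

theorem topGen_mem (i : ℕ) : topGen n ℓ i ∈ stepGens n ℓ i := by
  unfold topGen
  split_ifs with h
  · exact Or.inl ⟨_, by omega, by omega, rfl⟩
  · exact Or.inr ⟨by omega, rfl⟩

theorem topGen_apply_ne_zero (hℓ : StrictMonoOn ℓ (Set.Icc 1 (n - 2))) {i : ℕ}
    (hi : i ∈ Set.Icc 1 (n - 2)) {b : Fin n} (hb : (b : ℕ) = n - i) : topGen n ℓ i b ≠ 0 := by
  obtain ⟨h1, h2⟩ := Set.mem_Icc.1 hi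
  unfold topGen
  split_ifs with h
  · rw [lexGen_apply, if_pos (by omega : (b : ℕ) + 1 = n + 1 - i)]
    omega
  · have hle : ℓ (n - i) ≤ ℓ i :=
      hℓ.monotoneOn (Set.mem_Icc.2 ⟨by omega, by omega⟩) hi (by omega)
    rw [tailGen_apply, if_pos (by omega : (b : ℕ) + 1 = n - i + 1)]
    omega

theorem eq_topGen_of_mem_stepGens {i : ℕ} {u : Fin n →₀ ℕ}
    (hu : u ∈ stepGens n ℓ i) {b : Fin n} (hb : u b ≠ 0) (hbi : n ≤ b + i) :
    u = topGen n ℓ i := by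
  unfold topGen
  rcases hu with ⟨j, hj, hij, rfl⟩ | ⟨h, rfl⟩
  · rw [if_pos (by omega)]
    congr 1
    rw [lexGen_apply] at hb
    split_ifs at hb <;> omega
  · rw [if_neg (by omega)]

end GeneratorProperties

/-! ### Corners of the explicit ideal -/

section Corners

variable {K : Type*} [Field K] {n : ℕ} {ℓ : ℕ → ℕ} {I : Ideal (MvPolynomial (Fin n) K)}

theorem isStronglyStable_of_stepGens (hℓ : StrictMonoOn ℓ (Set.Icc 1 (n - 2)))
    (hI : I = monomialIdeal K (⋃ i ∈ Set.Icc 1 (n - 2), stepGens n ℓ i))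
    (hG : minGens I = ⋃ i ∈ Set.Icc 1 (n - 2), stepGens n ℓ i) : IsStronglyStable I := by
  refine ⟨⟨_, hI⟩, fun u hu b hb a hab => ?_⟩
  rw [hG] at hu
  simp only [Set.mem_iUnion, exists_prop] at hu
  obtain ⟨i, hi, hu⟩ := hu
  obtain ⟨i', hi', v, hv, hle⟩ :=
    exists_stepGens_le_exchange hℓ hi hu (Finsupp.mem_support_iff.1 hb) hab
  rw [hI, monomial_mem_monomialIdeal_iff]
  exact ⟨v, Set.mem_biUnion hi' hv, hle⟩

theorem initialDegree_monomialIdeal {A : Set (Fin n →₀ ℕ)} {d : ℕ} (hA : ∀ u ∈ A, d ≤ u.degree)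
    (hd : ∃ u ∈ A, u.degree = d) : initialDegree (monomialIdeal K A) = d := by
  obtain ⟨u, hu, hud⟩ := hd
  have hmem : d ∈ {s | ∃ f ∈ monomialIdeal K A, f ≠ 0 ∧ f.IsHomogeneous s} :=
    ⟨monomial u 1, monomial_mem_monomialIdeal_iff.2 ⟨u, hu, le_rfl⟩, by simp,
      isHomogeneous_monomial _ hud⟩
  refine le_antisymm (Nat.sInf_le hmem) (le_csInf ⟨d, hmem⟩ ?_)
  rintro s ⟨f, hf, hf0, hfs⟩
  obtain ⟨m, hm⟩ := ne_zero_iff.1 hf0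
  obtain ⟨v, hv, hvm⟩ := mem_monomialIdeal_iff.1 hf m (mem_support_iff.2 hm)
  have hms : m.degree = s := by
    rw [Finsupp.degree_eq_weight_one]
    exact hfs hm
  rw [← hms]
  exact (hA v hv).trans (Finsupp.degree_mono hvm)

/-- An index set all of whose elements precede the last variable of a generator of degree `ℓ_i`
consists of indices below `n - i`. -/
theorem subset_of_not_dominates {i : ℕ} (hi : i ≤ n) {u : Fin n →₀ ℕ} (hu : u ∈ stepGens n ℓ i)
    {σ : Finset (Fin n)} (hσ : ¬ Dominates σ u) :
    σ ⊆ Finset.univ.filter fun a : Fin n => (a : ℕ) < n - i := by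
  intro a ha
  rw [Finset.mem_filter]
  refine ⟨Finset.mem_univ _, ?_⟩
  by_contra hai
  refine hσ ⟨a, ha, fun b hb => ?_⟩
  have := le_of_mem_stepGens hi hu hb
  rw [Fin.le_def]
  omega

theorem card_filter_fin_lt {p : ℕ} (hp : p ≤ n) :
    (Finset.univ.filter fun a : Fin n => (a : ℕ) < p).card = p := by
  rw [Fin.card_filter_val_lt, min_eq_right hp]

/-- All nonzero Betti numbers lie weakly to the left of some `(n - i, ℓ_i)` in row `ℓ_i`. -/
theorem gradedBetti_stepGens_ne_zero (hI : IsStronglyStable I) (hℓ_one : ℓ 1 = 2)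
    (hℓ : StrictMonoOn ℓ (Set.Icc 1 (n - 2)))
    (hG : minGens I = ⋃ i ∈ Set.Icc 1 (n - 2), stepGens n ℓ i) {c j : ℕ}
    (h : gradedBetti I c (c + j) ≠ 0) : ∃ i ∈ Set.Icc 1 (n - 2), j = ℓ i ∧ c ≤ n - i := by
  rw [hI.gradedBetti_eq] at h
  obtain ⟨⟨u, σ⟩, hu, hdeg, hcard, hdom⟩ := Set.nonempty_of_ncard_ne_zero h
  rw [hG] at hu
  simp only [Set.mem_iUnion, exists_prop] at hu hdeg hcard hdom
  obtain ⟨i, hi, hu⟩ := hu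
  have hi2 := hi.2
  have := degree_of_mem_stepGens hℓ_one hℓ hi hu
  have hle := Finset.card_le_card (subset_of_not_dominates (by omega) hu hdom)
  rw [card_filter_fin_lt (Nat.sub_le _ _)] at hle
  exact ⟨i, hi, by omega, by omega⟩

theorem gradedBetti_stepGens_eq_one (hI : IsStronglyStable I) (hℓ_one : ℓ 1 = 2)
    (hℓ : StrictMonoOn ℓ (Set.Icc 1 (n - 2)))
    (hG : minGens I = ⋃ i ∈ Set.Icc 1 (n - 2), stepGens n ℓ i) {i : ℕ}
    (hi : i ∈ Set.Icc 1 (n - 2)) : gradedBetti I (n - i) (n - i + ℓ i) = 1 := by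
  obtain ⟨h1, h2⟩ := Set.mem_Icc.1 hi
  rw [hI.gradedBetti_eq, Set.ncard_eq_one]
  refine ⟨(topGen n ℓ i, Finset.univ.filter fun a : Fin n => (a : ℕ) < n - i), ?_⟩
  ext ⟨u, σ⟩
  rw [Set.mem_singleton_iff, Prod.mk.injEq]
  constructor
  · rintro ⟨hu, hdeg, hcard, hdom⟩
    rw [hG] at hu
    simp only [Set.mem_iUnion, exists_prop] at hu hdeg hcard hdom
    obtain ⟨i', hi', hu⟩ := hu
    have hdeg' := degree_of_mem_stepGens hℓ_one hℓ hi' hu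
    obtain rfl : i' = i := hℓ.injOn hi' hi (by omega)
    have hσ := Finset.eq_of_subset_of_card_le (subset_of_not_dominates (by omega) hu hdom)
      (by rw [card_filter_fin_lt (Nat.sub_le _ _), hcard])
    refine ⟨?_, hσ⟩
    -- `σ` contains the index `n - i - 1`, so `u` involves a variable of larger index
    obtain ⟨b, hb, hlt⟩ : ∃ b, u b ≠ 0 ∧ ¬ b ≤ (⟨n - i' - 1, by omega⟩ : Fin n) := by
      by_contra! h
      refine hdom ⟨⟨n - i' - 1, by omega⟩, ?_, h⟩
      rw [hσ, Finset.mem_filter]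
      exact ⟨Finset.mem_univ _, by dsimp only; omega⟩
    rw [Fin.le_def] at hlt
    dsimp only at hlt
    exact eq_topGen_of_mem_stepGens hu hb (by omega)
  · rintro ⟨rfl, rfl⟩
    have hmem := topGen_mem (n := n) (ℓ := ℓ) i
    refine ⟨hG ▸ Set.mem_biUnion hi hmem, ?_, card_filter_fin_lt (Nat.sub_le _ _), ?_⟩
    · dsimp only
      rw [degree_of_mem_stepGens hℓ_one hℓ hi hmem, add_comm]
    · rintro ⟨a, ha, h⟩
      have hle := h ⟨n - i, by omega⟩ (topGen_apply_ne_zero hℓ hi rfl)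
      rw [Finset.mem_filter] at ha
      rw [Fin.le_def] at hle
      dsimp only at hle
      omega

/-- If the nonzero Betti numbers lie in the rows `ℓ_i` and row `ℓ_i` ends in column `k_i`, with `k`
decreasing and `ℓ` increasing, then the ends of the rows are the corners. -/
theorem corners_eq_of_gradedBetti {r : ℕ} {k : ℕ → ℕ} (hk : StrictAntiOn k (Set.Icc 1 r))
    (hℓ : StrictMonoOn ℓ (Set.Icc 1 r))
    (hne : ∀ i ∈ Set.Icc 1 r, gradedBetti I (k i) (k i + ℓ i) ≠ 0)
    (h : ∀ c j, gradedBetti I c (c + j) ≠ 0 → ∃ i ∈ Set.Icc 1 r, j = ℓ i ∧ c ≤ k i) :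
    corners I = {p | ∃ i ∈ Set.Icc 1 r, p = (k i, ℓ i)} := by
  ext ⟨c, j⟩
  simp only [corners, Set.mem_ofPred_eq]
  constructor
  · rintro ⟨hcj, hext⟩
    obtain ⟨i, hi, rfl, hle⟩ := h c j hcj
    refine ⟨i, hi, ?_⟩
    by_contra hcontra
    exact hne i hi (hext (k i) (ℓ i) hle le_rfl (Ne.symm hcontra))
  · rintro ⟨i, hi, heq⟩
    obtain ⟨rfl, rfl⟩ := Prod.mk.inj heq
    refine ⟨hne i hi, fun c j hc hj hcj => by_contra fun hb => hcj ?_⟩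
    obtain ⟨i', hi', rfl, hle⟩ := h c j hb
    have h1 : i ≤ i' := (hℓ.le_iff_le hi hi').1 hj
    have h2 : i' ≤ i := (hk.le_iff_ge hi hi').1 (hc.trans hle)
    obtain rfl : i = i' := le_antisymm h1 h2
    rw [le_antisymm hle hc]

end Corners

end

theorem mainTheorem5 (K : Type*) [Field K] (n : ℕ) (hn : 4 ≤ n) (k ℓ : ℕ → ℕ)
    (hk_le : k 1 ≤ n - 1) (hk : StrictAntiOn k (Set.Icc 1 (n - 2))) (hk_ge : 2 ≤ k (n - 2))
    (hℓ_one : ℓ 1 = 2) (hℓ : StrictMonoOn ℓ (Set.Icc 1 (n - 2))) :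
    ((∃ I : Ideal (MvPolynomial (Fin n) K), IsStronglyStable I ∧ initialDegree I = 2 ∧
        corners I = {p | ∃ i ∈ Set.Icc 1 (n - 2), p = (k i, ℓ i)}) ↔ k 1 + 1 = n) ∧
    (k 1 + 1 = n →
      ∃ I : Ideal (MvPolynomial (Fin n) K),
        I = monomialIdeal K (⋃ i ∈ Set.Icc 1 (n - 2), cornerGens n (n - 2) k ℓ i) ∧
        minGens I = ⋃ i ∈ Set.Icc 1 (n - 2), cornerGens n (n - 2) k ℓ i ∧
        IsStronglyStable I ∧ initialDegree I = 2 ∧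
        corners I = {p | ∃ i ∈ Set.Icc 1 (n - 2), p = (k i, ℓ i)} ∧
        ∀ i ∈ Set.Icc 1 (n - 2), gradedBetti I (k i) (k i + ℓ i) = 1) := by
  have hk_eq := eq_sub_of_strictAntiOn hk_le hk hk_ge
  have h1mem : 1 ∈ Set.Icc 1 (n - 2) := Set.mem_Icc.2 ⟨le_rfl, by omega⟩
  have hk1 : k 1 + 1 = n := by
    rw [hk_eq 1 h1mem]
    omega
  suffices h : ∃ I : Ideal (MvPolynomial (Fin n) K),
      I = monomialIdeal K (⋃ i ∈ Set.Icc 1 (n - 2), cornerGens n (n - 2) k ℓ i) ∧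
      minGens I = ⋃ i ∈ Set.Icc 1 (n - 2), cornerGens n (n - 2) k ℓ i ∧
      IsStronglyStable I ∧ initialDegree I = 2 ∧
      corners I = {p | ∃ i ∈ Set.Icc 1 (n - 2), p = (k i, ℓ i)} ∧
      ∀ i ∈ Set.Icc 1 (n - 2), gradedBetti I (k i) (k i + ℓ i) = 1 by
    refine ⟨⟨fun _ => hk1, fun _ => ?_⟩, fun _ => h⟩
    obtain ⟨I, -, -, hI, hdeg, hcor, -⟩ := h
    exact ⟨I, hI, hdeg, hcor⟩
  have hgens : (⋃ i ∈ Set.Icc 1 (n - 2), cornerGens n (n - 2) k ℓ i) =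
      ⋃ i ∈ Set.Icc 1 (n - 2), stepGens n ℓ i :=
    Set.iUnion₂_congr fun i hi => cornerGens_eq hk_eq hi
  rw [hgens]
  set I := monomialIdeal K (⋃ i ∈ Set.Icc 1 (n - 2), stepGens n ℓ i) with hI
  have hG : minGens I = ⋃ i ∈ Set.Icc 1 (n - 2), stepGens n ℓ i :=
    minGens_monomialIdeal (isAntichain_iUnion_stepGens hℓ_one hℓ)
  have hstable : IsStronglyStable I := isStronglyStable_of_stepGens hℓ hI hG
  have hone : ∀ i ∈ Set.Icc 1 (n - 2), gradedBetti I (k i) (k i + ℓ i) = 1 := by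
    intro i hi
    rw [hk_eq i hi]
    exact gradedBetti_stepGens_eq_one hstable hℓ_one hℓ hG hi
  refine ⟨I, rfl, hG, hstable, initialDegree_monomialIdeal ?_ ?_, ?_, hone⟩
  · intro u hu
    simp only [Set.mem_iUnion, exists_prop] at hu
    obtain ⟨i, hi, hu⟩ := hu
    rw [degree_of_mem_stepGens hℓ_one hℓ hi hu]
    exact two_le_of_strictMonoOn hℓ_one hℓ hi.1 hi.2
  · exact ⟨topGen n ℓ 1, Set.mem_biUnion h1mem (topGen_mem 1),
      (degree_of_mem_stepGens hℓ_one hℓ h1mem (topGen_mem 1)).trans hℓ_one⟩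
  · refine corners_eq_of_gradedBetti hk hℓ (fun i hi => by rw [hone i hi]; exact one_ne_zero)
      fun c j h => ?_
    obtain ⟨i, hi, hj, hc⟩ := gradedBetti_stepGens_ne_zero hstable hℓ_one hℓ hG h
    exact ⟨i, hi, hj, hc.trans (hk_eq i hi).ge⟩
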